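/- Let $I$ be a finite undirected graph on $n$ vertices (parallel edges and loops allowed) with a conductance $c_e>0$ on every edge $e$. For vertices $s,t$, the effective resistance $\mathrm{Reff}_I(s,t)$ is the minimum of the energy $\sum_{e} g_e^2/c_e$ over all flows $g$ that send one unit from $s$ to $t$ (and $\infty$ if there is no such flow). The random walk in $I$ repeatedly chooses one of the edges incident with its current vertex, with probability proportional to its conductance, and traverses it. There is an absolute constant $C>0$ with the following property. Consider the (infinite) random walk $X_0,X_1,X_2,\dots$ in $I$ started at an arbitrary vertex $X_0=x_0$, an edge $f$ of $I$ with ends $u$ and $v$, a set $S$ of vertices of $I$, and a real number $R\ge 0$. Let $K$ be the number of times $t\ge 0$ at which the walk traverses $f$ from $X_t=u$ to $X_{t+1}=v$ and at which some vertex $s\in S\setminus\{X_0,\dots,X_t\}$ satisfies $\mathrm{Reff}_I(u,s)\le R$. Then $$\mathbf{E}[K]\;\le\; C\,\log(n)\, c_f\, R ;$$ in particular, $\mathbf{E}[K]=\tilde O(c_f R)$. -/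

import Mathlib

open MeasureTheory
open scoped ENNReal

/-- A finite undirected graph on vertex set `V` with edge set `E` and positive conductances on its
edges. Parallel edges and loops are allowed. `src` and `tgt` are the two ends of an edge, listed in
an arbitrary order: it only serves as the reference orientation for the sign of a flow. -/
structure WeightedGraph (V E : Type*) where
  src : E → V
  tgt : E → V
  c : E → ℝ
  c_pos : ∀ e, 0 < c e

namespace WeightedGraph

variable {V E : Type*}

/-- `e` is an edge with ends `x` and `y` (it can be traversed from `x` to `y`). -/
def Joins (G : WeightedGraph V E) (e : E) (x y : V) : Prop :=
  (G.src e = x ∧ G.tgt e = y) ∨ (G.src e = y ∧ G.tgt e = x)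

open Classical in
/-- Total conductance of the edges incident with `x`. -/
noncomputable def deg [Fintype E] (G : WeightedGraph V E) (x : V) : ℝ :=
  ∑ e with G.src e = x ∨ G.tgt e = x, G.c e

open Classical in
/-- Probability that a walk step from `x` uses the edge `e` and leads to `y`: an edge incident
with `x` is chosen with probability proportional to its conductance. -/
noncomputable def stepProb [Fintype E] (G : WeightedGraph V E) (x : V) (e : E) (y : V) : ℝ :=
  if G.Joins e x y then G.c e / G.deg x else 0

open Classical in
/-- `g` sends one unit of flow from `s` to `t`; `g e` is the flow on `e` from `src e` to `tgt e`. -/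
def IsUnitFlow [Fintype E] (G : WeightedGraph V E) (s t : V) (g : E → ℝ) : Prop :=
  ∀ x, (∑ e with G.src e = x, g e) - (∑ e with G.tgt e = x, g e)
    = (if x = s then 1 else 0) - (if x = t then 1 else 0)

/-- The energy of a flow; the resistance of `e` is `1 / c e`. -/
noncomputable def energy [Fintype E] (G : WeightedGraph V E) (g : E → ℝ) : ℝ :=
  ∑ e, g e ^ 2 / G.c e

/-- Effective resistance: the least energy of a unit flow from `s` to `t`. It is `∞` if there is
no such flow, that is, if `s` and `t` lie in different components. -/
noncomputable def reff [Fintype E] (G : WeightedGraph V E) (s t : V) : ℝ≥0∞ :=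
  ⨅ (g : E → ℝ) (_ : G.IsUnitFlow s t g), ENNReal.ofReal (G.energy g)

/-- `X` (visited vertices) and `Y` (traversed edges) form a random walk in `G` started at `x₀`:
`Y t` is the edge traversed in the step from `X t` to `X (t + 1)`. -/
structure IsRandomWalk [Fintype E] (G : WeightedGraph V E) {Ω : Type*} [MeasurableSpace Ω]
    (P : Measure Ω) (x₀ : V) (X : ℕ → Ω → V) (Y : ℕ → Ω → E) : Prop where
  isProbabilityMeasure : IsProbabilityMeasure P
  measurableSet_vertex : ∀ t x, MeasurableSet {ω | X t ω = x}
  measurableSet_edge : ∀ t e, MeasurableSet {ω | Y t ω = e}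
  start : ∀ᵐ ω ∂P, X 0 ω = x₀
  step : ∀ (t : ℕ) (x : ℕ → V) (e : ℕ → E),
    P {ω | (∀ i ≤ t + 1, X i ω = x i) ∧ ∀ i ≤ t, Y i ω = e i}
      = P {ω | (∀ i ≤ t, X i ω = x i) ∧ ∀ i < t, Y i ω = e i}
        * ENNReal.ofReal (G.stepProb (x t) (e t) (x (t + 1)))

/-- The set of outcomes in which step `t` traverses `f` from `u` to `v` while `u` is within
effective resistance `R` of some vertex of `S` that was not visited up to time `t`. -/
def traversalEvent [Fintype E] (G : WeightedGraph V E) {Ω : Type*}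
    (X : ℕ → Ω → V) (Y : ℕ → Ω → E) (f : E) (u v : V) (S : Set V) (R : ℝ) (t : ℕ) : Set Ω :=
  {ω | X t ω = u ∧ Y t ω = f ∧ X (t + 1) ω = v ∧
    ∃ s ∈ S, (∀ i ≤ t, X i ω ≠ s) ∧ G.reff u s ≤ ENNReal.ofReal R}

open Classical in
/-- The (possibly infinite) number of such traversals over the whole infinite walk. -/
noncomputable def traversalCount [Fintype E] (G : WeightedGraph V E) {Ω : Type*}
    (X : ℕ → Ω → V) (Y : ℕ → Ω → E) (f : E) (u v : V) (S : Set V) (R : ℝ) (ω : Ω) : ℝ≥0∞ :=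
  ∑' t : ℕ, if ω ∈ G.traversalEvent X Y f u v S R t then 1 else 0

end WeightedGraph

/-! ### One-step averages and the Laplacian. -/

namespace WeightedGraph

variable {V E : Type*}

/-! Let `A` be the set of vertices of `S` other than `u` within effective resistance `R` of `u`.
Each `s ∈ A` gets a potential `φ s` with values in `[0, 1]`, equal to `1` at `u` and `0` at `s`,
superharmonic off `s`, whose one-step average at `u` is below `1` by at least `1 / (R * deg u)`
(`exists_potential`).

Let `W` be the sum of `φ s` at the current vertex over the unvisited `s ∈ A`. Since `φ s s = 0`,
discarding `s` when it is reached does not change `W`, so `W` is a supermartingale. At `u`, with `k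
≥ 1` targets left, `W = k` and its expected drop is at least `k / (R * deg u)`. The concave function
`log (1 + W)` therefore drops there by at least `k / ((1 + k) * R * deg u) ≥ 1 / (2 * R * deg u)` in
expectation (`mul_average_log_le`). It is nonnegative and starts at most at `log n`, so the expected
number of visits to `u` with a target left is at most `2 * R * deg u * log n`
(`sum_measureReal_visit_le`). By the Markov property each such visit leaves through `f` to `v` with
probability `c f / deg u`; the degree cancels and `C = 2` works. -/

theorem deg_pos [Fintype E] (G : WeightedGraph V E) {x : V} {e : E}
    (h : G.src e = x ∨ G.tgt e = x) : 0 < G.deg x := by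
  classical
  refine Finset.sum_pos (fun e _ => G.c_pos e) ⟨e, ?_⟩
  simpa using h

theorem deg_nonneg [Fintype E] (G : WeightedGraph V E) (x : V) : 0 ≤ G.deg x :=
  Finset.sum_nonneg fun e _ => (G.c_pos e).le

theorem stepProb_nonneg [Fintype E] (G : WeightedGraph V E) (x : V) (e : E) (y : V) :
    0 ≤ G.stepProb x e y := by
  unfold stepProb
  split_ifs
  · exact div_nonneg (G.c_pos e).le (G.deg_nonneg x)
  · exact le_rfl

open Classical in
theorem deg_mul_sum_stepProb_mul [Fintype V] [Fintype E] (G : WeightedGraph V E) (x : V) (e : E)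
    (ψ : V → ℝ) :
    G.deg x * ∑ y, G.stepProb x e y * ψ y =
      if G.src e = x then G.c e * ψ (G.tgt e)
      else if G.tgt e = x then G.c e * ψ (G.src e) else 0 := by
  split_ifs with hs ht
  · have hd := (G.deg_pos (Or.inl hs)).ne'
    rw [Finset.sum_eq_single (G.tgt e)]
    · have hj : G.Joins e x (G.tgt e) := Or.inl ⟨hs, rfl⟩
      rw [stepProb, if_pos hj]
      field_simp
    · intro y _ hy
      rw [stepProb, if_neg, zero_mul]
      rintro (⟨-, h⟩ | ⟨h, h'⟩)
      · exact hy h.symm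
      · exact hy (by rw [h', ← hs, h])
    · simp
  · have hd := (G.deg_pos (Or.inr ht)).ne'
    rw [Finset.sum_eq_single (G.src e)]
    · have hj : G.Joins e x (G.src e) := Or.inr ⟨rfl, ht⟩
      rw [stepProb, if_pos hj]
      field_simp
    · intro y _ hy
      rw [stepProb, if_neg, zero_mul]
      rintro (⟨h, -⟩ | ⟨h, -⟩)
      · exact hs h
      · exact hy h.symm
    · simp
  · rw [Finset.sum_eq_zero, mul_zero]
    intro y _
    rw [stepProb, if_neg, zero_mul]
    rintro (⟨h, -⟩ | ⟨-, h⟩)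
    · exact hs h
    · exact ht h

/-- From a vertex of positive degree the step probabilities sum to one. -/
theorem sum_stepProb [Fintype V] [Fintype E] (G : WeightedGraph V E) {x : V}
    (hx : G.deg x ≠ 0) : ∑ e, ∑ y, G.stepProb x e y = 1 := by
  classical
  have h : G.deg x * ∑ e, ∑ y, G.stepProb x e y = G.deg x := by
    rw [Finset.mul_sum]
    conv_rhs => rw [deg, Finset.sum_filter]
    refine Finset.sum_congr rfl fun e _ => ?_
    have := G.deg_mul_sum_stepProb_mul x e (fun _ => 1)
    simp only [mul_one] at this
    rw [this]
    split_ifs <;> simp_all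
  exact mul_left_cancel₀ hx (by rw [h, mul_one])

/-- The one-step average of `ψ` under the random walk at `x`. -/
noncomputable def average [Fintype V] [Fintype E] (G : WeightedGraph V E) (ψ : V → ℝ) (x : V) : ℝ :=
  ∑ e, ∑ y, G.stepProb x e y * ψ y

open Classical in
/-- The divergence at `x` of the flow induced by the potential `φ`. -/
noncomputable def laplacian [Fintype E] (G : WeightedGraph V E) (φ : V → ℝ) (x : V) : ℝ :=
  ∑ e, G.c e * (φ (G.src e) - φ (G.tgt e)) *
    ((if G.src e = x then 1 else 0) - (if G.tgt e = x then 1 else 0))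

/-- Turns signs of the Laplacian into super-mean-value inequalities for the walk. A loop, counted
once in `deg`, contributes zero to both sides. -/
theorem deg_mul_sub_average [Fintype V] [Fintype E] (G : WeightedGraph V E) (φ : V → ℝ) (x : V) :
    G.deg x * (φ x - G.average φ x) = G.laplacian φ x := by
  classical
  have hdeg : G.deg x * φ x = ∑ e, if G.src e = x ∨ G.tgt e = x then G.c e * φ x else 0 := by
    rw [deg, Finset.sum_mul, Finset.sum_filter]
  rw [mul_sub, hdeg, average, Finset.mul_sum, ← Finset.sum_sub_distrib, laplacian]
  refine Finset.sum_congr rfl fun e _ => ?_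
  rw [G.deg_mul_sum_stepProb_mul x e φ]
  by_cases hs : G.src e = x <;> by_cases ht : G.tgt e = x <;> simp [hs, ht]
  all_goals ring

/-! ### Dirichlet energy, effective resistance and potentials. -/

/-- The Dirichlet energy of a potential. -/
noncomputable def dirichlet [Fintype E] (G : WeightedGraph V E) (φ : V → ℝ) : ℝ :=
  ∑ e, G.c e * (φ (G.src e) - φ (G.tgt e)) ^ 2

theorem sum_mul_laplacian [Fintype V] [Fintype E] (G : WeightedGraph V E) (φ ψ : V → ℝ) :
    ∑ x, ψ x * G.laplacian φ x =
      ∑ e, G.c e * (φ (G.src e) - φ (G.tgt e)) * (ψ (G.src e) - ψ (G.tgt e)) := by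
  classical
  simp_rw [laplacian, Finset.mul_sum]
  rw [Finset.sum_comm]
  refine Finset.sum_congr rfl fun e _ => ?_
  simp_rw [mul_left_comm (ψ _), ← Finset.mul_sum, mul_sub (ψ _), Finset.sum_sub_distrib]
  simp

theorem dirichlet_eq_sum_mul_laplacian [Fintype V] [Fintype E] (G : WeightedGraph V E)
    (φ : V → ℝ) : G.dirichlet φ = ∑ x, φ x * G.laplacian φ x := by
  rw [sum_mul_laplacian, dirichlet]
  exact Finset.sum_congr rfl fun e _ => by ring

theorem dirichlet_add_smul [Fintype V] [Fintype E] (G : WeightedGraph V E) (φ ψ : V → ℝ) (r : ℝ) :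
    G.dirichlet (φ + r • ψ) =
      G.dirichlet φ + 2 * r * ∑ x, ψ x * G.laplacian φ x + r ^ 2 * G.dirichlet ψ := by
  rw [sum_mul_laplacian]
  simp only [dirichlet, Finset.mul_sum, ← Finset.sum_add_distrib, Pi.add_apply, Pi.smul_apply,
    smul_eq_mul]
  exact Finset.sum_congr rfl fun e _ => by ring

/-- First-order optimality of a minimizer of the Dirichlet energy over a convex set. -/
theorem sum_sub_mul_laplacian_nonneg [Fintype V] [Fintype E] (G : WeightedGraph V E)
    {K : Set (V → ℝ)} (hK : Convex ℝ K) {φ ψ : V → ℝ} (hφ : φ ∈ K) (hψ : ψ ∈ K)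
    (hmin : IsMinOn G.dirichlet K φ) : 0 ≤ ∑ x, (ψ x - φ x) * G.laplacian φ x := by
  by_contra! hneg
  set a := ∑ x, (ψ x - φ x) * G.laplacian φ x with ha
  have hD : 0 ≤ G.dirichlet (ψ - φ) :=
    Finset.sum_nonneg fun e _ => mul_nonneg (G.c_pos e).le (sq_nonneg _)
  have key : ∀ r : ℝ, 0 < r → r ≤ 1 → 0 ≤ 2 * a + r * G.dirichlet (ψ - φ) := by
    intro r h0 h1
    have hmem : φ + r • (ψ - φ) ∈ K := hK.add_smul_sub_mem hφ hψ ⟨h0.le, h1⟩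
    have h := hmin hmem
    simp only [Set.mem_ofPred_eq, dirichlet_add_smul, Pi.sub_apply] at h
    rw [← ha] at h
    have : 0 ≤ r * (2 * a + r * G.dirichlet (ψ - φ)) := by nlinarith
    exact nonneg_of_mul_nonneg_right this h0
  -- This `r` lies in `(0, 1]` even if the energy vanishes, and makes the quadratic term at most
  -- `-a`, so that `2 * a + r * D ≤ a < 0`.
  have hpos : 0 < -a / (G.dirichlet (ψ - φ) - a) := div_pos (by linarith) (by linarith)
  have h := key _ hpos ((div_le_one (by linarith)).2 (by linarith))
  have h2 : -a / (G.dirichlet (ψ - φ) - a) * G.dirichlet (ψ - φ) ≤ -a := by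
    rw [div_mul_eq_mul_div, div_le_iff₀ (by linarith)]
    nlinarith
  linarith

/-- A potential `φ` with boundary values `1` at `u` and `0` at `s` bounds from below the energy of
each unit flow from `u` to `s`. -/
theorem one_le_energy_mul_dirichlet [Fintype V] [Fintype E] (G : WeightedGraph V E) {u s : V}
    {g : E → ℝ} (hg : G.IsUnitFlow u s g) {φ : V → ℝ} (hu : φ u = 1) (hs : φ s = 0) :
    1 ≤ G.energy g * G.dirichlet φ := by
  classical
  have h1 : ∑ e, g e * (φ (G.src e) - φ (G.tgt e)) = 1 := by
    have h : ∑ x, φ x * ((∑ e with G.src e = x, g e) - (∑ e with G.tgt e = x, g e)) = 1 := by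
      simp_rw [hg _]
      simp [mul_sub, Finset.sum_sub_distrib, hu, hs]
    rw [← h]
    simp_rw [Finset.sum_filter, ← Finset.sum_sub_distrib, Finset.mul_sum]
    rw [Finset.sum_comm]
    refine Finset.sum_congr rfl fun e _ => ?_
    simp [mul_sub, Finset.sum_sub_distrib, mul_comm]
  have hcs := Finset.sum_sq_le_sum_mul_sum_of_sq_le_mul Finset.univ
    (r := fun e => g e * (φ (G.src e) - φ (G.tgt e)))
    (f := fun e => g e ^ 2 / G.c e) (g := fun e => G.c e * (φ (G.src e) - φ (G.tgt e)) ^ 2)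
    (fun e _ => div_nonneg (sq_nonneg _) (G.c_pos e).le)
    (fun e _ => mul_nonneg (G.c_pos e).le (sq_nonneg _))
    (fun e _ => by have := (G.c_pos e).ne'; exact le_of_eq (by field_simp))
  rw [h1, one_pow] at hcs
  exact hcs

/-- Finiteness of `reff` supplies one flow, which forces positive Dirichlet energy; its inverse then
bounds every flow's energy, hence the infimum, from below. -/
theorem one_le_mul_dirichlet_of_reff_le [Fintype V] [Fintype E] (G : WeightedGraph V E) {u s : V}
    {R : ℝ} (hR : 0 ≤ R) (h : G.reff u s ≤ ENNReal.ofReal R) {φ : V → ℝ} (hu : φ u = 1)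
    (hs : φ s = 0) : 1 ≤ R * G.dirichlet φ := by
  have hD : 0 ≤ G.dirichlet φ :=
    Finset.sum_nonneg fun e _ => mul_nonneg (G.c_pos e).le (sq_nonneg _)
  obtain ⟨g, hg⟩ : ∃ g, G.IsUnitFlow u s g := by
    by_contra! hno
    rw [reff] at h
    simp [hno] at h
  have hDpos : 0 < G.dirichlet φ := by
    rcases hD.lt_or_eq with h' | h'
    · exact h'
    · have := G.one_le_energy_mul_dirichlet hg hu hs
      rw [← h'] at this
      linarith
  have hle : ENNReal.ofReal (1 / G.dirichlet φ) ≤ G.reff u s := by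
    refine le_iInf₂ fun g hg => ENNReal.ofReal_le_ofReal ?_
    rw [div_le_iff₀ hDpos]
    exact G.one_le_energy_mul_dirichlet hg hu hs
  have h' := (ENNReal.ofReal_le_ofReal_iff hR).1 (hle.trans h)
  rwa [div_le_iff₀ hDpos] at h'

/-- The potentials of a voltage source: a `[0, 1]`-valued function, superharmonic off `u` and `s`,
whose drop at `u` is at least the inverse of the effective resistance. -/
theorem exists_potential [Fintype V] [Fintype E] (G : WeightedGraph V E) {u s : V} (hus : s ≠ u)
    {R : ℝ} (hR : 0 ≤ R) (h : G.reff u s ≤ ENNReal.ofReal R) :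
    ∃ φ : V → ℝ, (∀ x, 0 ≤ φ x) ∧ (∀ x, φ x ≤ 1) ∧ φ u = 1 ∧ φ s = 0 ∧
      (∀ x, x ≠ u → x ≠ s → 0 ≤ G.laplacian φ x) ∧ 1 ≤ R * G.laplacian φ u := by
  classical
  -- Minimizing over a compact box avoids solving a Dirichlet problem and has a solution even if the
  -- graph is disconnected; one-sided optimality conditions suffice.
  set K : Set (V → ℝ) := Set.pi Set.univ fun x =>
    if x = u then {1} else if x = s then {0} else Set.Icc 0 1 with hK
  have hKc : IsCompact K := by
    refine isCompact_univ_pi fun x => ?_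
    split_ifs
    exacts [isCompact_singleton, isCompact_singleton, isCompact_Icc]
  have hKconv : Convex ℝ K := by
    refine convex_pi fun x _ => ?_
    split_ifs
    exacts [convex_singleton _, convex_singleton _, convex_Icc _ _]
  have hKne : K.Nonempty := by
    refine ⟨fun x => if x = u then 1 else 0, fun x _ => ?_⟩
    dsimp only
    split_ifs <;> simp
  have hcont : Continuous G.dirichlet := by
    unfold dirichlet
    fun_prop
  obtain ⟨φ, hφ, hmin⟩ := hKc.exists_isMinOn hKne hcont.continuousOn
  have hφu : φ u = 1 := by simpa using hφ u trivial
  have hφs : φ s = 0 := by simpa [hus] using hφ s trivial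
  have hbd : ∀ x, 0 ≤ φ x ∧ φ x ≤ 1 := by
    intro x
    by_cases hxu : x = u
    · simp [hxu, hφu]
    · by_cases hxs : x = s
      · simp [hxs, hφs]
      · simpa [hxu, hxs] using hφ x trivial
  have hvar : ∀ x, x ≠ u → x ≠ s → ∀ r ∈ Set.Icc (0 : ℝ) 1,
      0 ≤ (r - φ x) * G.laplacian φ x := by
    intro x hxu hxs r hr
    have hmem : Function.update φ x r ∈ K := by
      intro z _
      by_cases hz : z = x
      · subst hz
        simpa [hxu, hxs] using hr
      · simpa [hz] using hφ z trivial
    have := G.sum_sub_mul_laplacian_nonneg hKconv hφ hmem hmin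
    rwa [Finset.sum_eq_single x (fun z _ hz => by simp [hz]) (by simp),
      Function.update_self] at this
  refine ⟨φ, fun x => (hbd x).1, fun x => (hbd x).2, hφu, hφs, ?_, ?_⟩
  · intro x hxu hxs
    rcases (hbd x).2.lt_or_eq with hlt | heq
    · exact nonneg_of_mul_nonneg_right (hvar x hxu hxs 1 (by simp)) (by linarith)
    -- Where `φ x = 1` the variation towards `1` is void, but `x` is a maximum of `φ`, so every edge
    -- term is nonnegative.
    · refine Finset.sum_nonneg fun e _ => ?_
      rw [mul_assoc]
      refine mul_nonneg (G.c_pos e).le ?_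
      have h1 := (hbd (G.src e)).2
      have h2 := (hbd (G.tgt e)).2
      by_cases hs : G.src e = x <;> by_cases ht : G.tgt e = x <;> simp [hs, ht, heq, h1, h2]
  · refine (G.one_le_mul_dirichlet_of_reff_le hR h hφu hφs).trans
      (mul_le_mul_of_nonneg_left ?_ hR)
    -- The term at `u` dominates the energy: the one at `s` vanishes and lowering `φ x` to `0` shows
    -- the others to be nonpositive.
    rw [dirichlet_eq_sum_mul_laplacian, ← Finset.add_sum_erase _ _ (Finset.mem_univ u), hφu, one_mul]
    have : ∑ x ∈ Finset.univ.erase u, φ x * G.laplacian φ x ≤ 0 := by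
      refine Finset.sum_nonpos fun x hx => ?_
      by_cases hxs : x = s
      · simp [hxs, hφs]
      · have := hvar x (Finset.ne_of_mem_erase hx) hxs 0 (by simp)
        linarith
    linarith

end WeightedGraph

/-! ### Finite histories and the Markov property. -/

theorem MeasureTheory.measureReal_eq_sum_fiber {Ω ι : Type*} [MeasurableSpace Ω] [Fintype ι]
    (P : Measure Ω) [IsFiniteMeasure P] (Z : Ω → ι) (hZ : ∀ i, MeasurableSet {ω | Z ω = i})
    (s : Set Ω) : P.real s = ∑ i, P.real {ω | Z ω = i ∧ ω ∈ s} := by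
  have h := sum_measure_preimage_singleton (μ := P.restrict s) Finset.univ (f := Z)
    (fun i _ => hZ i)
  simp only [Finset.coe_univ, Set.preimage_univ, Measure.restrict_apply_univ] at h
  rw [measureReal_def, ← h, ENNReal.toReal_sum (fun _ _ => measure_ne_top _ _)]
  refine Finset.sum_congr rfl fun i _ => ?_
  have hZi : MeasurableSet (Z ⁻¹' {i}) := hZ i
  rw [Measure.restrict_apply hZi]
  rfl

namespace WeightedGraph

variable {V E : Type*}

/-- The vertices visited up to time `t` and the edges traversed before time `t`. -/
def history {Ω : Type*} (X : ℕ → Ω → V) (Y : ℕ → Ω → E) (t : ℕ) (ω : Ω) :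
    (Fin (t + 1) → V) × (Fin t → E) :=
  (fun i => X i ω, fun i => Y i ω)

theorem history_eq_iff {Ω : Type*} {X : ℕ → Ω → V} {Y : ℕ → Ω → E} {t : ℕ} {ω ω' : Ω} :
    history X Y t ω = history X Y t ω' ↔
      (∀ i ≤ t, X i ω = X i ω') ∧ ∀ i < t, Y i ω = Y i ω' := by
  simp only [history, Prod.mk.injEq, funext_iff, Fin.forall_iff, Nat.lt_succ_iff]

namespace IsRandomWalk

variable [Fintype E] {Ω : Type*} [MeasurableSpace Ω] {G : WeightedGraph V E}
  {P : Measure Ω} {x₀ : V} {X : ℕ → Ω → V} {Y : ℕ → Ω → E}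

theorem measurableSet_history [Fintype V] (hW : G.IsRandomWalk P x₀ X Y) (t : ℕ)
    (B : Set ((Fin (t + 1) → V) × (Fin t → E))) : MeasurableSet (history X Y t ⁻¹' B) := by
  let _ : MeasurableSpace ((Fin (t + 1) → V) × (Fin t → E)) := ⊤
  refine measurable_to_countable (fun ω => ?_) (MeasurableSpace.measurableSet_top (s := B))
  have : history X Y t ⁻¹' {history X Y t ω} =
      (⋂ i, ⋂ (_ : i ≤ t), {ω' | X i ω' = X i ω}) ∩ ⋂ i, ⋂ (_ : i < t), {ω' | Y i ω' = Y i ω} := by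
    ext ω'
    simp [history_eq_iff]
  rw [this]
  exact (MeasurableSet.iInter fun i => .iInter fun _ => hW.measurableSet_vertex i _).inter
    (MeasurableSet.iInter fun i => .iInter fun _ => hW.measurableSet_edge i _)

/-- The Markov property on an atom of the past. -/
theorem measureReal_history_step (hW : G.IsRandomWalk P x₀ X Y) (t : ℕ) (ω₀ : Ω) (e : E) (y : V) :
    P.real {ω | history X Y t ω = history X Y t ω₀ ∧ Y t ω = e ∧ X (t + 1) ω = y} =
      P.real {ω | history X Y t ω = history X Y t ω₀} * G.stepProb (X t ω₀) e y := by
  have h := hW.step t (fun i => if i ≤ t then X i ω₀ else y) (fun i => if i < t then Y i ω₀ else e)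
  have h1 : {ω | (∀ i ≤ t + 1, X i ω = if i ≤ t then X i ω₀ else y) ∧
      ∀ i ≤ t, Y i ω = if i < t then Y i ω₀ else e} =
      {ω | history X Y t ω = history X Y t ω₀ ∧ Y t ω = e ∧ X (t + 1) ω = y} := by
    ext ω
    simp only [Set.mem_ofPred_eq, history_eq_iff]
    constructor
    · rintro ⟨hX, hY⟩
      refine ⟨⟨fun i hi => ?_, fun i hi => ?_⟩, ?_, ?_⟩
      · simpa [hi] using hX i (by omega)
      · simpa [hi] using hY i hi.le
      · simpa using hY t le_rfl
      · simpa using hX (t + 1) le_rfl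
    · rintro ⟨⟨hX, hY⟩, he, hy⟩
      refine ⟨fun i hi => ?_, fun i hi => ?_⟩
      · split_ifs with hit
        · exact hX i hit
        · obtain rfl : i = t + 1 := by omega
          exact hy
      · split_ifs with hit
        · exact hY i hit
        · obtain rfl : i = t := by omega
          exact he
  have h2 : {ω | (∀ i ≤ t, X i ω = if i ≤ t then X i ω₀ else y) ∧
      ∀ i < t, Y i ω = if i < t then Y i ω₀ else e} =
      {ω | history X Y t ω = history X Y t ω₀} := by
    ext ω
    simp only [Set.mem_ofPred_eq, history_eq_iff]
    refine and_congr (forall₂_congr fun i hi => ?_) (forall₂_congr fun i hi => ?_) <;> simp [hi]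
  rw [h1, h2] at h
  simp only [le_refl, if_true, lt_irrefl, if_false, Nat.not_succ_le_self] at h
  rw [measureReal_def, h, ENNReal.toReal_mul, ENNReal.toReal_ofReal (G.stepProb_nonneg _ _ _)]
  rfl

/-- The Markov property for an event of the past on which the current vertex is `x`. -/
theorem measureReal_step [Fintype V] (hW : G.IsRandomWalk P x₀ X Y) {t : ℕ} {x : V} {B : Set Ω}
    (hB : ∀ ω ω', history X Y t ω = history X Y t ω' → ω ∈ B → ω' ∈ B)
    (hx : ∀ ω ∈ B, X t ω = x) (e : E) (y : V) :
    P.real {ω | ω ∈ B ∧ Y t ω = e ∧ X (t + 1) ω = y} = P.real B * G.stepProb x e y := by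
  have := hW.isProbabilityMeasure
  have hm : ∀ h, MeasurableSet {ω | history X Y t ω = h} := fun h => hW.measurableSet_history t {h}
  rw [measureReal_eq_sum_fiber P (history X Y t) hm, measureReal_eq_sum_fiber P (history X Y t) hm B,
    Finset.sum_mul]
  refine Finset.sum_congr rfl fun h _ => ?_
  by_cases hne : ∃ ω₀ ∈ B, history X Y t ω₀ = h
  · obtain ⟨ω₀, hω₀, rfl⟩ := hne
    have hiff : ∀ ω, history X Y t ω = history X Y t ω₀ → ω ∈ B := fun ω hω => hB _ _ hω.symm hω₀
    have h1 : {ω | history X Y t ω = history X Y t ω₀ ∧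
        ω ∈ {ω | ω ∈ B ∧ Y t ω = e ∧ X (t + 1) ω = y}} =
        {ω | history X Y t ω = history X Y t ω₀ ∧ Y t ω = e ∧ X (t + 1) ω = y} := by
      ext ω
      exact ⟨fun h => ⟨h.1, h.2.2⟩, fun h => ⟨h.1, hiff ω h.1, h.2⟩⟩
    have h2 : {ω | history X Y t ω = history X Y t ω₀ ∧ ω ∈ B} =
        {ω | history X Y t ω = history X Y t ω₀} := by
      ext ω
      exact ⟨fun h => h.1, fun h => ⟨h, hiff ω h⟩⟩
    rw [h1, h2, hW.measureReal_history_step, hx ω₀ hω₀]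
  · have h1 : {ω | history X Y t ω = h ∧ ω ∈ {ω | ω ∈ B ∧ Y t ω = e ∧ X (t + 1) ω = y}} = ∅ :=
      Set.eq_empty_of_forall_notMem fun ω hω => hne ⟨ω, hω.2.1, hω.1⟩
    have h2 : {ω | history X Y t ω = h ∧ ω ∈ B} = ∅ :=
      Set.eq_empty_of_forall_notMem fun ω hω => hne ⟨ω, hω.2, hω.1⟩
    rw [h1, h2, measureReal_empty, zero_mul]

end IsRandomWalk

/-! ### The Markov chain of pairs (position, unvisited targets). -/

open Classical in
/-- The vertices of `A` that are not visited up to time `t`. -/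
noncomputable def unvisited {Ω : Type*} (X : ℕ → Ω → V) (A : Finset V) (t : ℕ) (ω : Ω) : Finset V :=
  A.filter fun s => ∀ i ≤ t, X i ω ≠ s

open Classical in
theorem unvisited_succ {Ω : Type*} (X : ℕ → Ω → V) (A : Finset V) (t : ℕ) (ω : Ω) :
    unvisited X A (t + 1) ω = (unvisited X A t ω).erase (X (t + 1) ω) := by
  ext s
  simp only [unvisited, Finset.mem_filter, Finset.mem_erase, Nat.le_succ_iff, or_imp, forall_and,
    forall_eq]
  tauto

theorem unvisited_congr {Ω : Type*} {X : ℕ → Ω → V} {Y : ℕ → Ω → E} {t : ℕ} {ω ω' : Ω}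
    (h : history X Y t ω = history X Y t ω') (A : Finset V) :
    unvisited X A t ω = unvisited X A t ω' := by
  classical
  refine Finset.filter_congr fun s _ => forall₂_congr fun i hi => ?_
  rw [(history_eq_iff.1 h).1 i hi]

/-- The probability that the walk is at `x` at time `t` and that `a` is the part of `A` not visited
so far. -/
noncomputable def stateProb {Ω : Type*} [MeasurableSpace Ω] (P : Measure Ω) (X : ℕ → Ω → V)
    (A : Finset V) (t : ℕ) (x : V) (a : Finset V) : ℝ :=
  P.real {ω | X t ω = x ∧ unvisited X A t ω = a}

/-- Restricts later estimates to reachable states, the only ones where the potentials are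
controlled. -/
theorem stateProb_eq_zero {Ω : Type*} [MeasurableSpace Ω] (P : Measure Ω) (X : ℕ → Ω → V)
    (A : Finset V) (t : ℕ) {x : V} {a : Finset V} (h : ¬(a ⊆ A ∧ x ∉ a)) :
    stateProb P X A t x a = 0 := by
  classical
  have : {ω | X t ω = x ∧ unvisited X A t ω = a} = ∅ := by
    refine Set.eq_empty_of_forall_notMem fun ω hω => h ?_
    obtain ⟨rfl, rfl⟩ := hω
    exact ⟨Finset.filter_subset _ _, fun hx => (Finset.mem_filter.1 hx).2 t le_rfl rfl⟩
  rw [stateProb, this, measureReal_empty]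

namespace IsRandomWalk

variable [Fintype E] {Ω : Type*} [MeasurableSpace Ω] {G : WeightedGraph V E}
  {P : Measure Ω} {x₀ : V} {X : ℕ → Ω → V} {Y : ℕ → Ω → E}

theorem measurableSet_unvisited [Fintype V] (hW : G.IsRandomWalk P x₀ X Y) (A : Finset V) (t : ℕ)
    (a : Finset V) : MeasurableSet {ω | unvisited X A t ω = a} := by
  convert hW.measurableSet_history t (history X Y t '' {ω | unvisited X A t ω = a}) using 1
  ext ω
  constructor
  · exact fun h => ⟨ω, h, rfl⟩
  · rintro ⟨ω', h', hω⟩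
    exact (unvisited_congr hω.symm A).trans h'

theorem measureReal_state_step [Fintype V] (hW : G.IsRandomWalk P x₀ X Y) (A : Finset V) (t : ℕ) (x : V)
    (a : Finset V) (e : E) (y : V) :
    P.real {ω | (X t ω = x ∧ unvisited X A t ω = a) ∧ Y t ω = e ∧ X (t + 1) ω = y} =
      stateProb P X A t x a * G.stepProb x e y := by
  refine hW.measureReal_step (B := {ω | X t ω = x ∧ unvisited X A t ω = a}) ?_ (fun ω hω => hω.1) e y
  rintro ω ω' h ⟨hx, ha⟩
  exact ⟨((history_eq_iff.1 h).1 t le_rfl).symm.trans hx, (unvisited_congr h A).symm.trans ha⟩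

theorem sum_stateProb [Fintype V] (hW : G.IsRandomWalk P x₀ X Y) (A : Finset V) (t : ℕ) :
    ∑ x, ∑ a, stateProb P X A t x a = 1 := by
  have := hW.isProbabilityMeasure
  have h := measureReal_eq_sum_fiber P (fun ω => (X t ω, unvisited X A t ω))
    (fun z => by
      convert (hW.measurableSet_vertex t z.1).inter (hW.measurableSet_unvisited A t z.2) using 1
      ext ω
      simp [Prod.ext_iff]) Set.univ
  rw [probReal_univ, Fintype.sum_prod_type] at h
  simpa [stateProb, Prod.ext_iff] using h.symm

open Classical in
theorem stateProb_succ [Fintype V] (hW : G.IsRandomWalk P x₀ X Y) (A : Finset V) (t : ℕ) (y : V)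
    (b : Finset V) :
    stateProb P X A (t + 1) y b = ∑ x, ∑ a, ∑ e,
      if a.erase y = b then stateProb P X A t x a * G.stepProb x e y else 0 := by
  have := hW.isProbabilityMeasure
  have h := measureReal_eq_sum_fiber P (fun ω => (X t ω, unvisited X A t ω, Y t ω))
    (fun z => by
      convert ((hW.measurableSet_vertex t z.1).inter (hW.measurableSet_unvisited A t z.2.1)).inter
        (hW.measurableSet_edge t z.2.2) using 1
      ext ω
      simp [Prod.ext_iff, and_assoc]) {ω | X (t + 1) ω = y ∧ unvisited X A (t + 1) ω = b}
  rw [stateProb, h]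
  simp only [Fintype.sum_prod_type]
  refine Finset.sum_congr rfl fun x _ => Finset.sum_congr rfl fun a _ =>
    Finset.sum_congr rfl fun e _ => ?_
  split_ifs with hb
  · rw [← hW.measureReal_state_step]
    congr 1
    ext ω
    simp only [Set.mem_ofPred_eq, Prod.ext_iff, unvisited_succ]
    constructor
    · rintro ⟨⟨h1, h2, h3⟩, h4, -⟩
      exact ⟨⟨h1, h2⟩, h3, h4⟩
    · rintro ⟨⟨h1, h2⟩, h3, h4⟩
      exact ⟨⟨h1, h2, h3⟩, h4, by rw [h2, h4, hb]⟩
  · convert measureReal_empty (μ := P)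
    refine Set.eq_empty_of_forall_notMem fun ω hω => hb ?_
    simp only [Set.mem_ofPred_eq, Prod.ext_iff, unvisited_succ] at hω
    obtain ⟨⟨-, h2, -⟩, h4, h5⟩ := hω
    rw [← h5, h2, h4]

open Classical in
/-- The expectation of a function of the state at time `t + 1`, conditioned on the state at `t`. -/
theorem sum_stateProb_succ_mul [Fintype V] (hW : G.IsRandomWalk P x₀ X Y) (A : Finset V) (t : ℕ)
    (Φ : V → Finset V → ℝ) :
    ∑ y, ∑ b, stateProb P X A (t + 1) y b * Φ y b =
      ∑ x, ∑ a, stateProb P X A t x a * G.average (fun y => Φ y (a.erase y)) x := by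
  have h : ∀ y, ∑ b, stateProb P X A (t + 1) y b * Φ y b =
      ∑ x, ∑ a, ∑ e, stateProb P X A t x a * G.stepProb x e y * Φ y (a.erase y) := by
    intro y
    simp_rw [hW.stateProb_succ, Finset.sum_mul]
    rw [Finset.sum_comm]
    refine Finset.sum_congr rfl fun x _ => ?_
    rw [Finset.sum_comm]
    refine Finset.sum_congr rfl fun a _ => ?_
    rw [Finset.sum_comm]
    refine Finset.sum_congr rfl fun e _ => ?_
    simp [ite_mul]
  simp_rw [h]
  rw [Finset.sum_comm]
  refine Finset.sum_congr rfl fun x _ => ?_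
  rw [Finset.sum_comm]
  refine Finset.sum_congr rfl fun a _ => ?_
  rw [Finset.sum_comm]
  simp_rw [average, Finset.mul_sum, mul_assoc]

end IsRandomWalk

end WeightedGraph

/-! ### Drift of the logarithmic potential. -/

namespace WeightedGraph

variable {V E : Type*}

section Average

variable [Fintype V] [Fintype E]

theorem average_mono (G : WeightedGraph V E) {ψ χ : V → ℝ} (h : ∀ y, ψ y ≤ χ y) (x : V) :
    G.average ψ x ≤ G.average χ x :=
  Finset.sum_le_sum fun e _ => Finset.sum_le_sum fun y _ =>
    mul_le_mul_of_nonneg_left (h y) (G.stepProb_nonneg x e y)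

theorem average_affine (G : WeightedGraph V E) {x : V} (hx : G.deg x ≠ 0) (a b : ℝ) (ψ : V → ℝ) :
    G.average (fun y => a + b * ψ y) x = a + b * G.average ψ x := by
  simp_rw [average, mul_add, Finset.sum_add_distrib, ← Finset.sum_mul, G.sum_stepProb hx, one_mul,
    Finset.mul_sum, mul_left_comm b]

theorem average_sum (G : WeightedGraph V E) (φ : V → V → ℝ) (a : Finset V) (x : V) :
    G.average (fun y => ∑ s ∈ a, φ s y) x = ∑ s ∈ a, G.average (φ s) x := by
  simp_rw [average, Finset.mul_sum]
  rw [Finset.sum_comm]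
  conv_rhs => rw [Finset.sum_comm]
  rw [Finset.sum_comm]
  exact Finset.sum_congr rfl fun e _ => Finset.sum_comm

theorem average_of_deg_eq_zero (G : WeightedGraph V E) {x : V} (hx : G.deg x = 0) (ψ : V → ℝ) :
    G.average ψ x = 0 :=
  Finset.sum_eq_zero fun e _ => Finset.sum_eq_zero fun y _ => by simp [stepProb, hx]

/-- Jensen's inequality for `log (1 + ·)`, linearized at `w`. -/
theorem average_log_one_add_le (G : WeightedGraph V E) {x : V} (hx : G.deg x ≠ 0) {ψ : V → ℝ}
    (hψ : ∀ y, 0 ≤ ψ y) {w : ℝ} (hw : 0 ≤ w) :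
    G.average (fun y => Real.log (1 + ψ y)) x ≤
      Real.log (1 + w) - (w - G.average ψ x) / (1 + w) := by
  have hw' : 0 < 1 + w := by linarith
  have h : ∀ y, Real.log (1 + ψ y) ≤ (Real.log (1 + w) - w / (1 + w)) + 1 / (1 + w) * ψ y := by
    intro y
    have hy : 0 < 1 + ψ y := by linarith [hψ y]
    have := Real.log_le_sub_one_of_pos (div_pos hy hw')
    rw [Real.log_div hy.ne' hw'.ne'] at this
    have e : (1 + ψ y) / (1 + w) - 1 = 1 / (1 + w) * ψ y - w / (1 + w) := by
      field_simp
      ring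
    linarith
  refine (G.average_mono h x).trans (le_of_eq ?_)
  rw [G.average_affine hx]
  field_simp
  ring

end Average

open Classical in
/-- In one step from `(x, a)` the potential `log (1 + ∑ s ∈ a, φ s x)` does not increase in
expectation, and from `x = u` with `a` nonempty it decreases by at least `1 / (2 * κ)`. -/
theorem mul_average_log_le [Fintype V] [Fintype E] (G : WeightedGraph V E) {u : V}
    (hu : G.deg u ≠ 0) {κ : ℝ} (hκ : 0 ≤ κ) {φ : V → V → ℝ} {a : Finset V}
    (h0 : ∀ s ∈ a, ∀ x, 0 ≤ φ s x) (hφu : ∀ s ∈ a, φ s u = 1) (hφs : ∀ s ∈ a, φ s s = 0)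
    (hsuper : ∀ s ∈ a, ∀ x, x ≠ s → G.deg x ≠ 0 → G.average (φ s) x ≤ φ s x)
    (hdrop : ∀ s ∈ a, 1 ≤ κ * (1 - G.average (φ s) u)) {x : V} (hxa : x ∉ a) :
    κ * G.average (fun y => Real.log (1 + ∑ s ∈ a.erase y, φ s y)) x +
        (if x = u ∧ a.Nonempty then 1 / 2 else 0) ≤
      κ * Real.log (1 + ∑ s ∈ a, φ s x) := by
  have hnn : ∀ y, 0 ≤ ∑ s ∈ a, φ s y := fun y => Finset.sum_nonneg fun s hs => h0 s hs y
  have herase : ∀ y, ∑ s ∈ a.erase y, φ s y = ∑ s ∈ a, φ s y := by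
    intro y
    by_cases hy : y ∈ a
    · rw [← Finset.add_sum_erase _ _ hy, hφs y hy, zero_add]
    · rw [Finset.erase_eq_of_notMem hy]
  simp_rw [herase]
  by_cases hx : G.deg x = 0
  · have hxu : ¬(x = u ∧ a.Nonempty) := fun h => hu (h.1 ▸ hx)
    rw [G.average_of_deg_eq_zero hx, if_neg hxu, mul_zero, zero_add]
    exact mul_nonneg hκ (Real.log_nonneg (by linarith [hnn x]))
  have hJ := G.average_log_one_add_le hx hnn (hnn x)
  rw [average_sum] at hJ
  have hpos : 0 < 1 + ∑ s ∈ a, φ s x := by linarith [hnn x]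
  have hle : ∑ s ∈ a, G.average (φ s) x ≤ ∑ s ∈ a, φ s x :=
    Finset.sum_le_sum fun s hs => hsuper s hs x (fun h => hxa (h ▸ hs)) hx
  have hJκ := mul_le_mul_of_nonneg_left hJ hκ
  rw [mul_sub] at hJκ
  split_ifs with hcase
  · obtain ⟨rfl, hne⟩ := hcase
    have hcard : ∑ s ∈ a, φ s x = (a.card : ℝ) := by
      rw [Finset.sum_congr rfl hφu]
      simp
    have h1 : (1 : ℝ) ≤ a.card := by exact_mod_cast hne.card_pos
    have h2 : (a.card : ℝ) ≤ κ * (∑ s ∈ a, φ s x - ∑ s ∈ a, G.average (φ s) x) := by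
      rw [← Finset.sum_sub_distrib, Finset.mul_sum]
      calc (a.card : ℝ) = ∑ s ∈ a, (1 : ℝ) := by simp
        _ ≤ _ := Finset.sum_le_sum fun s hs => by rw [hφu s hs]; exact hdrop s hs
    -- The constant is `k / (1 + k) ≥ 1 / 2` for `k = a.card ≥ 1`.
    have h3 : 1 / 2 ≤ κ * ((∑ s ∈ a, φ s x - ∑ s ∈ a, G.average (φ s) x) /
        (1 + ∑ s ∈ a, φ s x)) := by
      rw [← mul_div_assoc, le_div_iff₀ hpos, hcard]
      rw [hcard] at h2
      linarith
    linarith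
  · have : 0 ≤ κ * ((∑ s ∈ a, φ s x - ∑ s ∈ a, G.average (φ s) x) / (1 + ∑ s ∈ a, φ s x)) :=
      mul_nonneg hκ (div_nonneg (by linarith) hpos.le)
    linarith

/-! ### Counting visits and traversals. -/

/-- Separates an event of the past from the next step, as the Markov property requires. Excluding `s
= u` loses nothing, since `u` is being visited. -/
theorem traversalEvent_eq [Fintype E] (G : WeightedGraph V E) {Ω : Type*} (X : ℕ → Ω → V)
    (Y : ℕ → Ω → E) (f : E) (u v : V) (S : Set V) (R : ℝ) {A : Finset V}
    (hA : ∀ s, s ∈ A ↔ s ∈ S ∧ s ≠ u ∧ G.reff u s ≤ ENNReal.ofReal R) (t : ℕ) :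
    G.traversalEvent X Y f u v S R t =
      {ω | ω ∈ {ω | X t ω = u ∧ (unvisited X A t ω).Nonempty} ∧ Y t ω = f ∧ X (t + 1) ω = v} := by
  classical
  ext ω
  simp only [traversalEvent, Set.mem_ofPred_eq, unvisited, Finset.Nonempty, Finset.mem_filter, hA]
  constructor
  · rintro ⟨h1, h2, h3, s, hs, hns, hr⟩
    exact ⟨⟨h1, s, ⟨hs, fun h => hns t le_rfl (h1.trans h.symm), hr⟩, hns⟩, h2, h3⟩
  · rintro ⟨⟨h1, s, ⟨hs, -, hr⟩, hns⟩, h2, h3⟩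
    exact ⟨h1, h2, h3, s, hs, hns, hr⟩

namespace IsRandomWalk

variable [Fintype V] [Fintype E] {Ω : Type*} [MeasurableSpace Ω] {G : WeightedGraph V E}
  {P : Measure Ω} {x₀ : V} {X : ℕ → Ω → V} {Y : ℕ → Ω → E}

open Classical in
theorem measureReal_visit (hW : G.IsRandomWalk P x₀ X Y) (A : Finset V) (u : V) (t : ℕ) :
    P.real {ω | X t ω = u ∧ (unvisited X A t ω).Nonempty} =
      ∑ x, ∑ a, stateProb P X A t x a * if x = u ∧ a.Nonempty then 1 else 0 := by
  have := hW.isProbabilityMeasure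
  rw [measureReal_eq_sum_fiber P _ (hW.measurableSet_unvisited A t), Finset.sum_eq_single u]
  · refine Finset.sum_congr rfl fun a _ => ?_
    by_cases ha : a.Nonempty
    · simp only [ha, and_self, if_true, mul_one, stateProb]
      congr 1
      ext ω
      constructor
      · exact fun h => ⟨h.2.1, h.1⟩
      · rintro ⟨h1, h2⟩
        exact ⟨h2, h1, by rwa [h2]⟩
    · simp only [ha, and_false, if_false, mul_zero]
      convert measureReal_empty (μ := P)
      refine Set.eq_empty_of_forall_notMem fun ω hω => ha ?_
      rw [← hω.1]
      exact hω.2.2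
  · intro x _ hx
    simp [hx]
  · simp

/-- The expected number of visits to `u` before all of `A` is visited is at most
`2 * R * deg u * log n`, if all of `A` lies within effective resistance `R` of `u`. -/
theorem sum_measureReal_visit_le (hW : G.IsRandomWalk P x₀ X Y) {u : V} (hu : G.deg u ≠ 0)
    {R : ℝ} (hR : 0 ≤ R) {A : Finset V} (hAu : u ∉ A)
    (hA : ∀ s ∈ A, G.reff u s ≤ ENNReal.ofReal R) (T : ℕ) :
    ∑ t ∈ Finset.range T, P.real {ω | X t ω = u ∧ (unvisited X A t ω).Nonempty} ≤
      2 * (R * G.deg u) * Real.log (Fintype.card V) := by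
  classical
  have hpot : ∀ s, ∃ φ : V → ℝ, s ∈ A → (∀ x, 0 ≤ φ x) ∧ (∀ x, φ x ≤ 1) ∧ φ u = 1 ∧ φ s = 0 ∧
      (∀ x, x ≠ u → x ≠ s → 0 ≤ G.laplacian φ x) ∧ 1 ≤ R * G.laplacian φ u := by
    intro s
    by_cases hs : s ∈ A
    · have hsu : s ≠ u := fun h => hAu (h ▸ hs)
      obtain ⟨φ, hφ⟩ := G.exists_potential hsu hR (hA s hs)
      exact ⟨φ, fun _ => hφ⟩
    · exact ⟨0, fun h => absurd h hs⟩
  choose φ hφ using hpot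
  set κ := R * G.deg u with hκdef
  have hκ : 0 ≤ κ := mul_nonneg hR (G.deg_nonneg u)
  set Φ : V → Finset V → ℝ := fun x a => Real.log (1 + ∑ s ∈ a, φ s x) with hΦ
  have hΦ0 : ∀ x, ∀ a ⊆ A, 0 ≤ Φ x a := fun x a ha =>
    Real.log_nonneg (by
      linarith [Finset.sum_nonneg fun s (hs : s ∈ a) => (hφ s (ha hs)).1 x])
  have hmass : ∀ t x a, 0 ≤ stateProb P X A t x a := fun _ _ _ => measureReal_nonneg
  set Ψ : ℕ → ℝ := fun t => ∑ x, ∑ a, stateProb P X A t x a * Φ x a with hΨ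
  have hΨ0 : ∀ t, 0 ≤ Ψ t := by
    refine fun t => Finset.sum_nonneg fun x _ => Finset.sum_nonneg fun a _ => ?_
    by_cases h : a ⊆ A ∧ x ∉ a
    · exact mul_nonneg (hmass t x a) (hΦ0 x a h.1)
    · rw [stateProb_eq_zero P X A t h, zero_mul]
  have hstart : Ψ 0 ≤ Real.log (Fintype.card V) := by
    calc Ψ 0 ≤ ∑ x, ∑ a, stateProb P X A 0 x a * Real.log (Fintype.card V) := by
          refine Finset.sum_le_sum fun x _ => Finset.sum_le_sum fun a _ => ?_
          by_cases h : a ⊆ A ∧ x ∉ a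
          · refine mul_le_mul_of_nonneg_left ?_ (hmass 0 x a)
            refine Real.log_le_log ?_ ?_
            · linarith [Finset.sum_nonneg fun s (hs : s ∈ a) => (hφ s (h.1 hs)).1 x]
            · have h1 : ∑ s ∈ a, φ s x ≤ a.card := by
                calc ∑ s ∈ a, φ s x ≤ ∑ s ∈ a, (1 : ℝ) :=
                      Finset.sum_le_sum fun s hs => (hφ s (h.1 hs)).2.1 x
                  _ = a.card := by simp
              -- The current vertex is not in `a`; this absorbs the `1` in `log (1 + W)` and gives
              -- exactly `log n`.
              have h2 : a.card + 1 ≤ Fintype.card V := by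
                rw [← Finset.card_insert_of_notMem h.2]
                exact Finset.card_le_univ _
              have h3 : (a.card : ℝ) + 1 ≤ Fintype.card V := by exact_mod_cast h2
              linarith
          · rw [stateProb_eq_zero P X A 0 h, zero_mul, zero_mul]
      _ = Real.log (Fintype.card V) := by
          simp_rw [← Finset.sum_mul]
          rw [hW.sum_stateProb, one_mul]
  have hstep : ∀ t, κ * Ψ (t + 1) +
      1 / 2 * P.real {ω | X t ω = u ∧ (unvisited X A t ω).Nonempty} ≤ κ * Ψ t := by
    intro t
    rw [hW.measureReal_visit, hΨ]
    dsimp only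
    rw [hW.sum_stateProb_succ_mul]
    simp only [Finset.mul_sum, ← Finset.sum_add_distrib]
    refine Finset.sum_le_sum fun x _ => Finset.sum_le_sum fun a _ => ?_
    by_cases h : a ⊆ A ∧ x ∉ a
    · have hdiff := G.mul_average_log_le hu hκ (φ := φ) (a := a)
        (fun s hs => (hφ s (h.1 hs)).1) (fun s hs => (hφ s (h.1 hs)).2.2.1)
        (fun s hs => (hφ s (h.1 hs)).2.2.2.1) ?_ ?_ h.2
      · have := mul_le_mul_of_nonneg_left hdiff (hmass t x a)
        rw [hΦ]
        dsimp only
        split_ifs at this ⊢ <;> linarith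
      · intro s hs y hys hy
        obtain ⟨-, -, -, -, h5, h6⟩ := hφ s (h.1 hs)
        -- Superharmonicity is also needed at `u`, where it follows from the drop bound.
        have hlap : 0 ≤ G.laplacian (φ s) y := by
          by_cases hyu : y = u
          · subst hyu
            by_contra! hneg
            nlinarith
          · exact h5 y hyu hys
        rw [← deg_mul_sub_average] at hlap
        have := nonneg_of_mul_nonneg_right hlap ((G.deg_nonneg y).lt_of_ne' hy)
        linarith
      · intro s hs
        obtain ⟨-, -, h3, -, -, h6⟩ := hφ s (h.1 hs)
        rwa [← deg_mul_sub_average, h3, ← mul_assoc] at h6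
    · rw [stateProb_eq_zero P X A t h]
      simp
  have hsum : ∀ T, κ * Ψ T + 1 / 2 * ∑ t ∈ Finset.range T,
      P.real {ω | X t ω = u ∧ (unvisited X A t ω).Nonempty} ≤ κ * Ψ 0 := by
    intro T
    induction T with
    | zero => simp
    | succ T ih =>
      rw [Finset.sum_range_succ, mul_add]
      linarith [hstep T]
  have h1 := hsum T
  have h2 := mul_nonneg hκ (hΨ0 T)
  have h3 := mul_le_mul_of_nonneg_left hstart hκ
  linarith

theorem lintegral_traversalCount_le (hW : G.IsRandomWalk P x₀ X Y) {f : E} {u v : V}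
    (hf : G.Joins f u v) (S : Set V) {R : ℝ} (hR : 0 ≤ R) :
    ∫⁻ ω, G.traversalCount X Y f u v S R ω ∂P ≤
      ENNReal.ofReal (2 * Real.log (Fintype.card V) * (G.c f * R)) := by
  classical
  have := hW.isProbabilityMeasure
  have hu : 0 < G.deg u := G.deg_pos (e := f) (hf.imp And.left And.right)
  set A : Finset V := Finset.univ.filter
    fun s => s ∈ S ∧ s ≠ u ∧ G.reff u s ≤ ENNReal.ofReal R with hAdef
  have hA : ∀ s, s ∈ A ↔ s ∈ S ∧ s ≠ u ∧ G.reff u s ≤ ENNReal.ofReal R := by simp [hAdef]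
  have hev := G.traversalEvent_eq X Y f u v S R hA
  have hmeas : ∀ t, MeasurableSet (G.traversalEvent X Y f u v S R t) := by
    intro t
    rw [hev t]
    have hne : MeasurableSet {ω | (unvisited X A t ω).Nonempty} := by
      convert (hW.measurableSet_unvisited A t ∅).compl using 1
      ext ω
      simp [Finset.nonempty_iff_ne_empty]
    exact ((hW.measurableSet_vertex t u).inter hne).inter
      ((hW.measurableSet_edge t f).inter (hW.measurableSet_vertex (t + 1) v))
  have hprob : ∀ t, P.real (G.traversalEvent X Y f u v S R t) =
      P.real {ω | X t ω = u ∧ (unvisited X A t ω).Nonempty} * (G.c f / G.deg u) := by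
    intro t
    have hstep : G.stepProb u f v = G.c f / G.deg u := if_pos hf
    rw [hev t, ← hstep]
    refine hW.measureReal_step ?_ (fun ω hω => hω.1) f v
    rintro ω ω' h ⟨h1, h2⟩
    refine ⟨((history_eq_iff.1 h).1 t le_rfl).symm.trans h1, ?_⟩
    rwa [← unvisited_congr h A]
  have hcount : ∫⁻ ω, G.traversalCount X Y f u v S R ω ∂P =
      ∑' t, P (G.traversalEvent X Y f u v S R t) := by
    unfold traversalCount
    have hind : ∀ t ω, (if ω ∈ G.traversalEvent X Y f u v S R t then (1 : ℝ≥0∞) else 0) =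
        (G.traversalEvent X Y f u v S R t).indicator 1 ω := fun t ω => by
      simp [Set.indicator_apply]
    simp_rw [hind]
    rw [lintegral_tsum fun t => (measurable_one.indicator (hmeas t)).aemeasurable]
    exact tsum_congr fun t => lintegral_indicator_one (hmeas t)
  -- The visit bound is uniform in the time horizon, so partial sums suffice.
  rw [hcount, ENNReal.tsum_eq_iSup_nat]
  refine iSup_le fun T => ?_
  have hT : ∑ t ∈ Finset.range T, P (G.traversalEvent X Y f u v S R t) =
      ENNReal.ofReal (∑ t ∈ Finset.range T, P.real (G.traversalEvent X Y f u v S R t)) := by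
    rw [ENNReal.ofReal_sum_of_nonneg fun _ _ => measureReal_nonneg]
    exact Finset.sum_congr rfl fun t _ => (ofReal_measureReal (measure_ne_top _ _)).symm
  rw [hT]
  refine ENNReal.ofReal_le_ofReal ?_
  simp_rw [hprob]
  rw [← Finset.sum_mul]
  have hvis := hW.sum_measureReal_visit_le hu.ne' hR (A := A) (by simp [hAdef])
    (fun s hs => ((hA s).1 hs).2.2) T
  refine (mul_le_mul_of_nonneg_right hvis (div_nonneg (G.c_pos f).le hu.le)).trans (le_of_eq ?_)
  field_simp

end IsRandomWalk

end WeightedGraph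

theorem mainTheorem6 :
    ∃ C : ℝ, 0 < C ∧
      ∀ {V : Type*} {E : Type*} {Ω : Type*} [Fintype V] [Fintype E] [MeasurableSpace Ω]
        (G : WeightedGraph V E) (P : Measure Ω) (x₀ : V) (X : ℕ → Ω → V) (Y : ℕ → Ω → E),
        G.IsRandomWalk P x₀ X Y →
        ∀ (f : E) (u v : V), G.Joins f u v →
        ∀ (S : Set V) (R : ℝ), 0 ≤ R →
          ∫⁻ ω, G.traversalCount X Y f u v S R ω ∂P
            ≤ ENNReal.ofReal (C * Real.log (Fintype.card V) * (G.c f * R)) := by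
  exact ⟨2, two_pos, fun G P x₀ X Y hW f u v hf S R hR => hW.lintegral_traversalCount_le hf S hR⟩
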